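/- Consider private information retrieval (PIR) codes with $N=2$ databases and $K=2$ messages. Let $\mathcal X,\mathcal Y$ be finite alphabets with $|\mathcal X|\ge 2$, let $L\ge 1$, and let $W_1,W_2$ be independent messages, each uniformly distributed on $\mathcal X^L$. Let $\mathsf F$ be a random key that is uniformly distributed on a non-empty finite set $\mathcal F$, independently of the messages. A PIR code consists of the following functions, for $n\in\{1,2\}$: - storage functions $\Phi_n:\mathcal X^{2L}\to\mathcal S_n$ with $\mathcal S_n$ a finite set; database $n$ stores $S_n=\Phi_n(W_1,W_2)$; - query functions $\phi_n:\{1,2\}\times\mathcal F\to\mathcal Q_n$; the query to database $n$ when message $k$ is desired is $Q_n^{[k]}=\phi_n(k,\mathsf F)$; - answer length functions $\ell_n:\mathcal Q_n\to\{0,1,2,\ldots\}$; - answer functions $\varphi_n$ that map $q\in\mathcal Q_n$ and $s\in\mathcal S_n$ to $\varphi_n(q,s)\in\mathcal Y^{\ell_n(q)}$; the answer of database $n$ is $A_n^{[k]}=\varphi_n(Q_n^{[k]},S_n)$; together with a reconstruction function $\psi$. They must satisfy - correctness: $\psi(A_1^{[k]},A_2^{[k]},k,\mathsf F)=W_k$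 for $k=1,2$; - privacy: $\Pr(Q_n^{[1]}=q)=\Pr(Q_n^{[2]}=q)$ for $n=1,2$ and all $q\in\mathcal Q_n$. The average storage cost and the average download cost per database are $$\alpha=\frac12\sum_{n=1}^{2}\frac{\log_2|\mathcal S_n|}{L\log_2|\mathcal X|},\qquad \beta=\frac12\sum_{n=1}^{2}\frac{\log_2|\mathcal Y|\;\mathbb E\big[\ell_n(Q_n^{[k]})\big]}{L\log_2|\mathcal X|},$$ where $\beta$ does not depend on $k$, because of privacy. Then every such code that is capacity-achieving, i.e., has $\beta=\frac34$, satisfies $\alpha\ge\frac43$. -/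

import Mathlib

/-- The encoding, query, answer and reconstruction functions of an `N`-server private information
retrieval (PIR) storage scheme for `K` messages, each made of `L` symbols of the alphabet `X`.
`Y` is the alphabet of the answers, `F` is the set in which the random key takes its values,
`S n` is the set of contents that database `n` can store, and `Q n` is the set of queries that
server `n` can accommodate. A tuple of all messages is `w : Fin K → Fin L → X`. -/
structure PIRScheme (N K L : ℕ) (X Y F : Type*) (S Q : Fin N → Type*) where
  /-- storage encoding functions -/
  store : (n : Fin N) → (Fin K → Fin L → X) → S n
  /-- query functions: desired message index and key to query -/
  query : (n : Fin N) → Fin K → F → Q n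
  /-- answer length functions: the length depends on the query only -/
  len : (n : Fin N) → Q n → ℕ
  /-- answer functions: query and stored content to a word over `Y` of the prescribed length -/
  answer : (n : Fin N) → (q : Q n) → S n → (Fin (len n q) → Y)
  /-- reconstruction function, from the desired message index, the key and the `N` answers -/
  decode : (k : Fin K) → (f : F) → ((n : Fin N) → Fin (len n (query n k f)) → Y) → (Fin L → X)

namespace PIRScheme

variable {N K L : ℕ} {X Y F : Type*} {S Q : Fin N → Type*}

/-- The retrieved message, when the messages are `w`, the key is `f` and message `k` is desired. -/
def retrieved (C : PIRScheme N K L X Y F S Q) (w : Fin K → Fin L → X) (k : Fin K) (f : F) :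
    Fin L → X :=
  C.decode k f (fun n => C.answer n (C.query n k f) (C.store n w))

/-- The distribution of the query sent to server `n` when message `k` is desired, the key being
uniformly distributed on `F`. -/
noncomputable def queryDist [Fintype F] [Nonempty F] (C : PIRScheme N K L X Y F S Q)
    (n : Fin N) (k : Fin K) : PMF (Q n) :=
  (PMF.uniformOfFintype F).map (C.query n k)

/-- The expected length of the answer of server `n` when message `k` is desired, the key being
uniformly distributed on `F`. -/
noncomputable def expectedLen [Fintype F] [Nonempty F] (C : PIRScheme N K L X Y F S Q)
    (n : Fin N) (k : Fin K) : ℝ :=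
  ∑ f : F, (PMF.uniformOfFintype F f).toReal * (C.len n (C.query n k f) : ℝ)

end PIRScheme

/-- A PIR storage code: a scheme whose retrieved message is always the desired one, and in which
the distribution of the query to any single server does not depend on the desired message. -/
structure PIRCode (N K L : ℕ) (X Y F : Type*) (S Q : Fin N → Type*) [Fintype F] [Nonempty F]
    extends PIRScheme N K L X Y F S Q where
  correctness : ∀ (w : Fin K → Fin L → X) (k : Fin K) (f : F), toPIRScheme.retrieved w k f = w k
  privacy : ∀ (k k' : Fin K) (n : Fin N) (q : Q n),
    toPIRScheme.queryDist n k q = toPIRScheme.queryDist n k' q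

namespace PIRCode

variable {N K L : ℕ} {X Y F : Type*} {S Q : Fin N → Type*} [Fintype F] [Nonempty F]

/-- The (operational) normalized storage cost of database `n`. -/
noncomputable def storageCostAt [Fintype X] [∀ n, Fintype (S n)]
    (_C : PIRCode N K L X Y F S Q) (n : Fin N) : ℝ :=
  Real.logb 2 (Fintype.card (S n)) / ((L : ℝ) * Real.logb 2 (Fintype.card X))

/-- The average (per database) storage cost. -/
noncomputable def storageCost [Fintype X] [∀ n, Fintype (S n)]
    (C : PIRCode N K L X Y F S Q) : ℝ :=
  (1 / (N : ℝ)) * ∑ n : Fin N, C.storageCostAt n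

/-- The (operational) normalized download cost of database `n`, when message `k` is desired. -/
noncomputable def downloadCostAt [Fintype X] [Fintype Y]
    (C : PIRCode N K L X Y F S Q) (k : Fin K) (n : Fin N) : ℝ :=
  Real.logb 2 (Fintype.card Y) * C.expectedLen n k / ((L : ℝ) * Real.logb 2 (Fintype.card X))

/-- The average (per database) download cost, when message `k` is desired. By privacy it does not
depend on `k`, see `PIRCode.downloadCost_eq`. -/
noncomputable def downloadCost [Fintype X] [Fintype Y]
    (C : PIRCode N K L X Y F S Q) (k : Fin K) : ℝ :=
  (1 / (N : ℝ)) * ∑ n : Fin N, C.downloadCostAt k n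

theorem expectedLen_eq (C : PIRCode N K L X Y F S Q) (n : Fin N) (k k' : Fin K) :
    C.expectedLen n k = C.expectedLen n k' := by
  have key : ∀ j : Fin K, ENNReal.ofReal (C.expectedLen n j)
      = ∑' q : Q n, C.queryDist n j q * (C.len n q : ENNReal) := by
    intro j
    classical
    unfold PIRScheme.expectedLen PIRScheme.queryDist
    rw [ENNReal.ofReal_sum_of_nonneg (fun f _ => by positivity)]
    simp_rw [PMF.map_apply, ← ENNReal.tsum_mul_right]
    rw [ENNReal.tsum_comm, tsum_fintype]
    refine Finset.sum_congr rfl fun f _ => ?_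
    rw [tsum_eq_single (C.query n j f) (by intro q hq; simp [hq])]
    rw [ENNReal.ofReal_mul ENNReal.toReal_nonneg, ENNReal.ofReal_toReal (PMF.apply_ne_top _ _)]
    simp
  have h0 : ∀ j : Fin K, 0 ≤ C.expectedLen n j := fun j =>
    Finset.sum_nonneg fun f _ => by positivity
  rw [← ENNReal.toReal_ofReal (h0 k), ← ENNReal.toReal_ofReal (h0 k'), key k, key k']
  simp_rw [C.privacy k k' n]

theorem downloadCost_eq [Fintype X] [Fintype Y] (C : PIRCode N K L X Y F S Q) (k k' : Fin K) :
    C.downloadCost k = C.downloadCost k' := by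
  unfold downloadCost downloadCostAt
  simp_rw [C.expectedLen_eq _ k k']

end PIRCode

/-! Write `ℓ = L log|X|`, with entropies in nats. A random variable on the uniform message pairs is
represented by the partition into its fibres: `r ⊓ s` is the joint variable, `r ≤ s` says that `r`
determines `s`, `⊥` is the full pair of messages and `⊤` is a constant.

Tightness. Let `A`, `B` be the two answers when `W_k` is desired. Then `2(H(A) + H(B)) ≥ 2H(A,B) ≥
H(A,W_k) + H(B,W_k)`. By privacy, the sum over the keys of the right side is unchanged if the
queries are those for the other message; the answers then determine that message, and submodularity
bounds each term below by `3ℓ`. So the mean download is at least `3ℓ/2`. `β = 3/4` means equality on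
average, hence equality for every key (`tight_of_sum_totalLen`, `tight_chain`).

Linking. Privacy lets a key for `W_0` be matched with a key for `W_1` so that one server receives
the same query and gives the same answer `B`; the other server gives `A` and `A'`. Tightness makes
`B` a function of `(A,W_0)` and of `(A',W_1)`, so `A, A'` and either message determine everything,
and `A`, `A'` are conditionally independent given either message. The Zhang–Yeung inequality,
applied to `W_0, W_1, A, A'`, then gives `3H(A,A') ≥ 2(H(A) + H(A')) + ℓ`
(`three_mul_msgEntropy_inf_ge`).

Conclusion. The database content determines `(A,A')`, so `log|S_n|` bounds `H(A,A')`. Averaging over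
keys and adding both servers, the answer entropies contribute `2 · 2 · 3ℓ/2`, whence `3(log|S_0| +
log|S_1|) ≥ 6ℓ + 2ℓ`, which is `α ≥ 4/3`. -/

open Classical in
/-- The mass of the class of `ω` under the equivalence relation `r`. -/
noncomputable def classMass {Ω : Type*} [Fintype Ω] (p : Ω → ℝ) (r : Setoid Ω) (ω : Ω) : ℝ :=
  ∑ ω', if r ω ω' then p ω' else 0

/-- The Shannon entropy (in nats) of the partition into the classes of `r`, under the weights `p`.
The joint entropy of two partitions is the entropy of `r ⊓ s`. -/
noncomputable def partEntropy {Ω : Type*} [Fintype Ω] (p : Ω → ℝ) (r : Setoid Ω) : ℝ :=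
  ∑ ω, p ω * -Real.log (classMass p r ω)

/-! ### Shannon inequalities for entropies of partitions. -/

section Entropy

variable {Ω : Type*} [Fintype Ω] {p : Ω → ℝ}

theorem le_classMass (hp : ∀ ω, 0 ≤ p ω) (r : Setoid Ω) (ω : Ω) : p ω ≤ classMass p r ω := by
  classical
  have h := Finset.single_le_sum (f := fun ω' => if r ω ω' then p ω' else 0)
    (fun i _ => by split_ifs <;> simp [hp]) (Finset.mem_univ ω)
  simpa [classMass, r.refl' ω] using h

theorem classMass_nonneg (hp : ∀ ω, 0 ≤ p ω) (r : Setoid Ω) (ω : Ω) : 0 ≤ classMass p r ω :=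
  (hp ω).trans (le_classMass hp r ω)

theorem classMass_congr (r : Setoid Ω) {ω ω' : Ω} (h : r ω ω') :
    classMass p r ω = classMass p r ω' := by
  classical
  unfold classMass
  refine Finset.sum_congr rfl fun x _ => ?_
  have : r ω x ↔ r ω' x := ⟨fun hx => r.trans' (r.symm' h) hx, fun hx => r.trans' h hx⟩
  simp [this]

theorem classMass_mono (hp : ∀ ω, 0 ≤ p ω) {r s : Setoid Ω} (h : r ≤ s) (ω : Ω) :
    classMass p r ω ≤ classMass p s ω := by
  classical
  unfold classMass
  refine Finset.sum_le_sum fun x _ => ?_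
  by_cases hx : r ω x
  · simp [hx, h hx]
  · simp only [hx, if_false]
    split_ifs <;> simp [hp]

theorem partEntropy_anti (hp : ∀ ω, 0 ≤ p ω) {r s : Setoid Ω} (h : r ≤ s) :
    partEntropy p s ≤ partEntropy p r := by
  unfold partEntropy
  refine Finset.sum_le_sum fun x _ => ?_
  rcases (hp x).eq_or_lt with h0 | h0
  · simp [← h0]
  · refine mul_le_mul_of_nonneg_left (neg_le_neg ?_) (hp x)
    exact Real.log_le_log (h0.trans_le (le_classMass hp r x)) (classMass_mono hp h x)

/-- The sum of `p / classMass` over a set contained in one class is at most `1`. -/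
theorem sum_div_classMass_le_one (hp : ∀ ω, 0 ≤ p ω) (r : Setoid Ω) (P : Ω → Prop)
    [DecidablePred P] (hP : ∀ x y, P x → P y → r x y) :
    ∑ ω, (if P ω then p ω / classMass p r ω else 0) ≤ 1 := by
  classical
  by_cases hex : ∃ x, P x
  · obtain ⟨x, hx⟩ := hex
    calc ∑ ω, (if P ω then p ω / classMass p r ω else 0)
        ≤ ∑ ω, (if r x ω then p ω else 0) / classMass p r x := by
          refine Finset.sum_le_sum fun ω _ => ?_
          by_cases h : P ω
          · simp [h, hP x ω hx h, classMass_congr r (hP x ω hx h)]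
          · simp only [h, if_false]
            refine div_nonneg ?_ (classMass_nonneg hp r x)
            split_ifs <;> simp [hp]
      _ = classMass p r x / classMass p r x := by rw [← Finset.sum_div]; rfl
      -- Only an inequality: the class may have mass zero, and then `0 / 0 = 0`.
      _ ≤ 1 := div_self_le_one _
  · push Not at hex
    simp [hex]

/-- Nonnegativity of conditional mutual information, from `log z ≤ z - 1` with `z = m(r ⊓ t) m(s ⊓
t) / (m(r ⊓ s ⊓ t) m(t))`. It remains to see that the `p`-mean of `z` is at most the total mass. -/
theorem partEntropy_submodular (hp : ∀ ω, 0 ≤ p ω) (r s t : Setoid Ω) :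
    partEntropy p (r ⊓ s ⊓ t) + partEntropy p t ≤
      partEntropy p (r ⊓ t) + partEntropy p (s ⊓ t) := by
  classical
  set m := classMass p with hm
  have hpt : ∀ ω, p ω * (Real.log (m (r ⊓ t) ω) + Real.log (m (s ⊓ t) ω)
      - Real.log (m (r ⊓ s ⊓ t) ω) - Real.log (m t ω)) ≤
      p ω * m (r ⊓ t) ω * m (s ⊓ t) ω / (m (r ⊓ s ⊓ t) ω * m t ω) - p ω := by
    intro ω
    rcases (hp ω).eq_or_lt with h0 | h0
    · simp [← h0]
    · have pos : ∀ u : Setoid Ω, 0 < m u ω := fun u => h0.trans_le (le_classMass hp u ω)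
      have h1 := pos (r ⊓ t)
      have h2 := pos (s ⊓ t)
      have h3 := pos (r ⊓ s ⊓ t)
      have h4 := pos t
      have := Real.log_le_sub_one_of_pos (x := m (r ⊓ t) ω * m (s ⊓ t) ω / (m (r ⊓ s ⊓ t) ω * m t ω))
        (by positivity)
      rw [Real.log_div (by positivity) (by positivity), Real.log_mul h1.ne' h2.ne',
        Real.log_mul h3.ne' h4.ne'] at this
      calc _ ≤ p ω * (m (r ⊓ t) ω * m (s ⊓ t) ω / (m (r ⊓ s ⊓ t) ω * m t ω) - 1) :=
            mul_le_mul_of_nonneg_left (by linarith) (hp ω)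
        _ = _ := by ring
  have hsum : ∑ ω, p ω * m (r ⊓ t) ω * m (s ⊓ t) ω / (m (r ⊓ s ⊓ t) ω * m t ω) ≤ ∑ ω, p ω := by
    -- The two masses in the numerator are expanded as sums over points `x` and `y`, and the sum
    -- over `ω` is moved inside.
    have hswap : ∑ ω, p ω * m (r ⊓ t) ω * m (s ⊓ t) ω / (m (r ⊓ s ⊓ t) ω * m t ω) =
        ∑ x, ∑ y, (if t x y then p x * p y / m t x else 0) *
          ∑ ω, if (r ⊓ t) ω x ∧ (s ⊓ t) ω y then p ω / m (r ⊓ s ⊓ t) ω else 0 := by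
      have h1 : ∀ ω, p ω * m (r ⊓ t) ω * m (s ⊓ t) ω / (m (r ⊓ s ⊓ t) ω * m t ω) =
          ∑ x, ∑ y, (if t x y then p x * p y / m t x else 0) *
            if (r ⊓ t) ω x ∧ (s ⊓ t) ω y then p ω / m (r ⊓ s ⊓ t) ω else 0 := by
        intro ω
        have h2 : p ω * m (r ⊓ t) ω * m (s ⊓ t) ω / (m (r ⊓ s ⊓ t) ω * m t ω) =
          (p ω / (m (r ⊓ s ⊓ t) ω * m t ω)) * (m (r ⊓ t) ω * m (s ⊓ t) ω) := by ring
        rw [h2, hm]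
        conv_lhs => rw [classMass.eq_1 p (r ⊓ t), classMass.eq_1 p (s ⊓ t), Finset.sum_mul_sum,
          Finset.mul_sum]
        refine Finset.sum_congr rfl fun x _ => ?_
        rw [Finset.mul_sum]
        refine Finset.sum_congr rfl fun y _ => ?_
        by_cases hx : (r ⊓ t) ω x
        · by_cases hy : (s ⊓ t) ω y
          · have hxy : t x y := t.trans' (t.symm' hx.2) hy.2
            have hωx : classMass p t ω = classMass p t x := classMass_congr t hx.2
            simp only [hx, hy, hxy, and_self, if_true, hωx]
            ring
          · simp [hy]
        · simp [hx]
      simp_rw [h1, Finset.mul_sum]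
      rw [Finset.sum_comm]
      refine Finset.sum_congr rfl fun x _ => ?_
      rw [Finset.sum_comm]
    rw [hswap]
    refine Finset.sum_le_sum fun x _ => ?_
    have hnn := classMass_nonneg hp t x
    calc _ ≤ ∑ y, (if t x y then p x * p y / m t x else 0) * 1 := by
          refine Finset.sum_le_sum fun y _ => mul_le_mul_of_nonneg_left ?_ ?_
          -- All `ω` linked to `x` by `r ⊓ t` and to `y` by `s ⊓ t` lie in a single class of `r ⊓ s
          -- ⊓ t`.
          · refine sum_div_classMass_le_one hp _ _ ?_
            rintro a b ⟨ha, ha'⟩ ⟨hb, hb'⟩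
            exact ⟨⟨r.trans' ha.1 (r.symm' hb.1), s.trans' ha'.1 (s.symm' hb'.1)⟩,
              t.trans' ha.2 (t.symm' hb.2)⟩
          · split_ifs
            · exact div_nonneg (mul_nonneg (hp x) (hp y)) hnn
            · exact le_rfl
      _ = p x * (m t x / m t x) := by
          conv_rhs => enter [2, 1]; rw [hm, classMass]
          rw [Finset.sum_div, Finset.mul_sum]
          refine Finset.sum_congr rfl fun y _ => ?_
          split_ifs <;> ring
      _ ≤ p x * 1 := mul_le_mul_of_nonneg_left (div_self_le_one _) (hp x)
      _ = p x := mul_one _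
  have hfin := (Finset.sum_le_sum fun ω (_ : ω ∈ Finset.univ) => hpt ω)
  rw [Finset.sum_sub_distrib] at hfin
  have hexp : ∑ ω, p ω * (Real.log (m (r ⊓ t) ω) + Real.log (m (s ⊓ t) ω)
      - Real.log (m (r ⊓ s ⊓ t) ω) - Real.log (m t ω)) =
      partEntropy p (r ⊓ s ⊓ t) + partEntropy p t -
        (partEntropy p (r ⊓ t) + partEntropy p (s ⊓ t)) := by
    unfold partEntropy
    rw [← Finset.sum_add_distrib, ← Finset.sum_add_distrib, ← Finset.sum_sub_distrib]
    refine Finset.sum_congr rfl fun ω _ => ?_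
    ring
  linarith

theorem partEntropy_top (h1 : ∑ ω, p ω = 1) : partEntropy p ⊤ = 0 := by
  simp [partEntropy, classMass, h1]

theorem partEntropy_inf_le_add (hp : ∀ ω, 0 ≤ p ω) (h1 : ∑ ω, p ω = 1) (r s : Setoid Ω) :
    partEntropy p (r ⊓ s) ≤ partEntropy p r + partEntropy p s := by
  have := partEntropy_submodular hp r s ⊤
  simpa [partEntropy_top h1] using this

/-- Again `log z ≤ z - 1`, with `z = 1 / (m |α|)`; each fibre contributes at most `1` to `∑ p / m`.
-/
theorem partEntropy_ker_le_log_card (hp : ∀ ω, 0 ≤ p ω) (h1 : ∑ ω, p ω = 1) {α : Type*}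
    [Fintype α] (f : Ω → α) : partEntropy p (Setoid.ker f) ≤ Real.log (Fintype.card α) := by
  classical
  have hne : Nonempty Ω := by
    by_contra h
    rw [not_nonempty_iff] at h
    simp at h1
  have : Nonempty α := hne.map f
  have hM : (0 : ℝ) < Fintype.card α := by exact_mod_cast Fintype.card_pos
  set m := classMass p (Setoid.ker f) with hm
  have hpt : ∀ ω, p ω * -Real.log (m ω) ≤
      p ω * Real.log (Fintype.card α) + (p ω / m ω / Fintype.card α - p ω) := by
    intro ω
    rcases (hp ω).eq_or_lt with h0 | h0
    · simp [← h0]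
    · have hpos : 0 < m ω := h0.trans_le (le_classMass hp _ ω)
      have := Real.log_le_sub_one_of_pos (x := 1 / (m ω * Fintype.card α)) (by positivity)
      rw [Real.log_div one_ne_zero (by positivity), Real.log_mul hpos.ne' hM.ne',
        Real.log_one] at this
      calc _ ≤ p ω * (Real.log (Fintype.card α) + (1 / (m ω * Fintype.card α) - 1)) :=
            mul_le_mul_of_nonneg_left (by linarith) (hp ω)
        _ = _ := by field_simp
  have hcount : ∑ ω, p ω / m ω ≤ Fintype.card α := by
    calc ∑ ω, p ω / m ω = ∑ a : α, ∑ ω, (if f ω = a then p ω / m ω else 0) := by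
          rw [Finset.sum_comm]; simp
      _ ≤ ∑ a : α, (1 : ℝ) := Finset.sum_le_sum fun a _ =>
          sum_div_classMass_le_one hp _ _ fun x y hx hy => hx.trans hy.symm
      _ = Fintype.card α := by simp
  have hfin := (Finset.sum_le_sum fun ω (_ : ω ∈ Finset.univ) => hpt ω)
  rw [Finset.sum_add_distrib, Finset.sum_sub_distrib, ← Finset.sum_mul, ← Finset.sum_div, h1] at hfin
  have : (∑ ω, p ω / m ω) / Fintype.card α ≤ 1 := (div_le_one hM).2 hcount
  unfold partEntropy
  linarith

theorem partEntropy_uniform_bot [Nonempty Ω] :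
    partEntropy (fun _ : Ω => (Fintype.card Ω : ℝ)⁻¹) ⊥ = Real.log (Fintype.card Ω) := by
  classical
  have h : (Fintype.card Ω : ℝ) ≠ 0 := by exact_mod_cast Fintype.card_ne_zero
  simp [partEntropy, classMass, h]

theorem sum_mul_comp {Ω' : Type*} [Fintype Ω'] [DecidableEq Ω] {p' : Ω' → ℝ} {π : Ω' → Ω}
    (hπ : ∀ ω, ∑ x, (if π x = ω then p' x else 0) = p ω) (g : Ω → ℝ) :
    ∑ x, p' x * g (π x) = ∑ ω, p ω * g ω := by
  simp_rw [← hπ, Finset.sum_mul]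
  rw [Finset.sum_comm]
  refine Finset.sum_congr rfl fun x _ => ?_
  simp

theorem classMass_comap {Ω' : Type*} [Fintype Ω'] [DecidableEq Ω] {p' : Ω' → ℝ} {π : Ω' → Ω}
    (hπ : ∀ ω, ∑ x, (if π x = ω then p' x else 0) = p ω) (r : Setoid Ω) (x : Ω') :
    classMass p' (r.comap π) x = classMass p r (π x) := by
  classical
  have := sum_mul_comp hπ fun ω => if r (π x) ω then 1 else 0
  simpa [classMass, Setoid.comap_rel] using this

/-- Entropy is invariant under a measure preserving map. -/
theorem partEntropy_comap {Ω' : Type*} [Fintype Ω'] [DecidableEq Ω] {p' : Ω' → ℝ} {π : Ω' → Ω}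
    (hπ : ∀ ω, ∑ x, (if π x = ω then p' x else 0) = p ω) (r : Setoid Ω) :
    partEntropy p' (r.comap π) = partEntropy p r := by
  unfold partEntropy
  simp_rw [classMass_comap hπ]
  exact sum_mul_comp hπ fun ω => -Real.log (classMass p r ω)

end Entropy

/-! ### Conditionally independent copies and the Zhang–Yeung inequality. -/

/-- The law of a pair of points that lie in the same class of `c`, are conditionally independent
given this class, and both have law `p`. -/
noncomputable def copyWeight {Ω : Type*} [Fintype Ω] (p : Ω → ℝ) (c : Setoid Ω) (x : Ω × Ω) : ℝ :=
  open Classical in if c x.1 x.2 then p x.1 * p x.2 / classMass p c x.1 else 0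

section Copy

variable {Ω : Type*} [Fintype Ω] {p : Ω → ℝ}

theorem copyWeight_nonneg (hp : ∀ ω, 0 ≤ p ω) (c : Setoid Ω) (x : Ω × Ω) :
    0 ≤ copyWeight p c x := by
  unfold copyWeight
  split_ifs
  · exact div_nonneg (mul_nonneg (hp _) (hp _)) (classMass_nonneg hp c _)
  · exact le_rfl

theorem copyWeight_swap (c : Setoid Ω) (x y : Ω) :
    copyWeight p c (x, y) = copyWeight p c (y, x) := by
  unfold copyWeight
  by_cases h : c x y
  · simp only [h, c.symm' h, if_true, classMass_congr c h]
    ring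
  · have h' : ¬ c y x := fun h' => h (c.symm' h')
    simp [h, h']

theorem sum_copyWeight (hp : ∀ ω, 0 ≤ p ω) (c : Setoid Ω) (x : Ω) :
    ∑ y, copyWeight p c (x, y) = p x := by
  classical
  have h : ∑ y, copyWeight p c (x, y) = p x * (classMass p c x / classMass p c x) := by
    conv_rhs => enter [2, 1]; rw [classMass]
    rw [Finset.sum_div, Finset.mul_sum]
    refine Finset.sum_congr rfl fun y _ => ?_
    unfold copyWeight
    dsimp only
    split_ifs <;> ring
  rw [h]
  rcases (hp x).eq_or_lt with h0 | h0
  · simp [← h0]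
  · rw [div_self (h0.trans_le (le_classMass hp c x)).ne', mul_one]

theorem sum_copyWeight_eq_one (hp : ∀ ω, 0 ≤ p ω) (h1 : ∑ ω, p ω = 1) (c : Setoid Ω) :
    ∑ x, copyWeight p c x = 1 := by
  rw [Fintype.sum_prod_type]
  simp_rw [sum_copyWeight hp, h1]

theorem copyWeight_marginal_fst [DecidableEq Ω] (hp : ∀ ω, 0 ≤ p ω) (c : Setoid Ω) (ω : Ω) :
    ∑ x : Ω × Ω, (if x.1 = ω then copyWeight p c x else 0) = p ω := by
  rw [Fintype.sum_prod_type, Finset.sum_eq_single ω]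
  · simpa using sum_copyWeight hp c ω
  · intro b _ hb
    simp [hb]
  · simp

theorem copyWeight_marginal_snd [DecidableEq Ω] (hp : ∀ ω, 0 ≤ p ω) (c : Setoid Ω) (ω : Ω) :
    ∑ x : Ω × Ω, (if x.2 = ω then copyWeight p c x else 0) = p ω := by
  rw [Fintype.sum_prod_type_right, Finset.sum_eq_single ω]
  · simpa [copyWeight_swap c _ ω] using sum_copyWeight hp c ω
  · intro b _ hb
    simp [hb]
  · simp

theorem partEntropy_copy_fst (hp : ∀ ω, 0 ≤ p ω) (c r : Setoid Ω) :
    partEntropy (copyWeight p c) (r.comap Prod.fst) = partEntropy p r := by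
  classical
  exact partEntropy_comap (copyWeight_marginal_fst hp c) r

theorem partEntropy_copy_snd (hp : ∀ ω, 0 ≤ p ω) (c r : Setoid Ω) :
    partEntropy (copyWeight p c) (r.comap Prod.snd) = partEntropy p r := by
  classical
  exact partEntropy_comap (copyWeight_marginal_snd hp c) r

/-- Inside one class of `c` the weight is a product measure divided by the mass of the class, so the
double sum factors. -/
theorem classMass_copy (f g c : Setoid Ω) {x y : Ω} (h : c x y) :
    classMass (copyWeight p c) (f.comap Prod.fst ⊓ g.comap Prod.snd ⊓ c.comap Prod.fst) (x, y) =
      classMass p (f ⊓ c) x * classMass p (g ⊓ c) y / classMass p c x := by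
  classical
  conv_rhs => rw [classMass.eq_1 p (f ⊓ c), classMass.eq_1 p (g ⊓ c), Finset.sum_mul_sum,
    Finset.sum_div]
  conv_lhs => rw [classMass, Fintype.sum_prod_type]
  refine Finset.sum_congr rfl fun a _ => ?_
  rw [Finset.sum_div]
  refine Finset.sum_congr rfl fun b _ => ?_
  unfold copyWeight
  have hL : (f.comap Prod.fst ⊓ g.comap Prod.snd ⊓ c.comap Prod.fst) (x, y) (a, b) ↔
      (f x a ∧ g y b) ∧ c x a := Iff.rfl
  have hf : (f ⊓ c) x a ↔ f x a ∧ c x a := Iff.rfl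
  have hg : (g ⊓ c) y b ↔ g y b ∧ c y b := Iff.rfl
  simp only [hL, hf, hg]
  by_cases hxa : c x a
  · have hab : c a b ↔ c y b :=
      ⟨fun k => c.trans' (c.symm' h) (c.trans' hxa k),
        fun k => c.trans' (c.symm' hxa) (c.trans' h k)⟩
    rw [classMass_congr c hxa]
    by_cases h1 : f x a <;> by_cases h2 : g y b <;> by_cases h3 : c y b <;>
      simp [hxa, hab, h1, h2, h3]
  · simp [hxa]

/-- The copy is conditionally independent of the original, given the common class. -/
theorem partEntropy_copy (hp : ∀ ω, 0 ≤ p ω) (f g c : Setoid Ω) :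
    partEntropy (copyWeight p c) (f.comap Prod.fst ⊓ g.comap Prod.snd ⊓ c.comap Prod.fst) =
      partEntropy p (f ⊓ c) + partEntropy p (g ⊓ c) - partEntropy p c := by
  classical
  rw [← partEntropy_copy_fst hp c (f ⊓ c), ← partEntropy_copy_snd hp c (g ⊓ c),
    ← partEntropy_copy_fst hp c c]
  unfold partEntropy
  rw [← Finset.sum_add_distrib, ← Finset.sum_sub_distrib]
  refine Finset.sum_congr rfl fun x _ => ?_
  obtain ⟨x, y⟩ := x
  by_cases h0 : copyWeight p c (x, y) = 0
  · simp [h0]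
  have h : c x y := by
    by_contra h
    exact h0 (by simp [copyWeight, h])
  have hx : 0 < p x := (hp x).lt_of_ne fun h => h0 (by simp [copyWeight, ← h])
  have hy : 0 < p y := (hp y).lt_of_ne fun h => h0 (by simp [copyWeight, ← h])
  have h1 := hx.trans_le (le_classMass hp (f ⊓ c) x)
  have h2 := hy.trans_le (le_classMass hp (g ⊓ c) y)
  have h3 := hx.trans_le (le_classMass hp c x)
  rw [classMass_copy f g c h, classMass_comap (copyWeight_marginal_fst hp c),
    classMass_comap (copyWeight_marginal_snd hp c), classMass_comap (copyWeight_marginal_fst hp c),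
    Real.log_div (by positivity) h3.ne', Real.log_mul h1.ne' h2.ne']
  ring

theorem classMass_congr_of_support {Ω : Type*} [Fintype Ω] {p : Ω → ℝ} {r s : Setoid Ω} {x : Ω}
    (h : ∀ y, p y ≠ 0 → (r x y ↔ s x y)) : classMass p r x = classMass p s x := by
  classical
  refine Finset.sum_congr rfl fun y _ => ?_
  by_cases hy : p y = 0
  · simp [hy]
  · simp [h y hy]

/-- Entropy only depends on the partition of the support. -/
theorem partEntropy_congr_of_support {Ω : Type*} [Fintype Ω] {p : Ω → ℝ} {r s : Setoid Ω}
    (h : ∀ x y, p x ≠ 0 → p y ≠ 0 → (r x y ↔ s x y)) : partEntropy p r = partEntropy p s := by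
  refine Finset.sum_congr rfl fun x _ => ?_
  by_cases hx : p x = 0
  · simp [hx]
  · rw [classMass_congr_of_support fun y => h x y hx]

theorem rel_of_copyWeight_ne_zero {c : Setoid Ω} {x : Ω × Ω} (h : copyWeight p c x ≠ 0) :
    c x.1 x.2 := by
  by_contra h'
  exact h (by simp [copyWeight, h'])

/-- A variable that is determined by `c` has the same value at both coordinates. -/
theorem partEntropy_copy_snd_inf_fst (hp : ∀ ω, 0 ≤ p ω) {c s : Setoid Ω} (hs : c ≤ s)
    (r : Setoid Ω) :
    partEntropy (copyWeight p c) (r.comap Prod.snd ⊓ s.comap Prod.fst) =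
      partEntropy p (r ⊓ s) := by
  rw [← partEntropy_copy_snd hp c (r ⊓ s)]
  refine partEntropy_congr_of_support fun x y hx hy => ?_
  have hx' := hs (rel_of_copyWeight_ne_zero hx)
  have hy' := hs (rel_of_copyWeight_ne_zero hy)
  have : s x.1 y.1 ↔ s x.2 y.2 :=
    ⟨fun k => s.trans' (s.symm' hx') (s.trans' k hy'),
      fun k => s.trans' hx' (s.trans' k (s.symm' hy'))⟩
  exact and_congr Iff.rfl this

/-- The Zhang–Yeung inequality
`I(C;D) ≤ 2 I(C;D|A) + I(C;D|B) + I(A;B) + I(A;C|D) + I(A;D|C)`, a non-Shannon inequality. -/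
theorem zhang_yeung (hp : ∀ ω, 0 ≤ p ω) (h1 : ∑ ω, p ω = 1) (A B C D : Setoid Ω) :
    partEntropy p C + partEntropy p D - partEntropy p (C ⊓ D) ≤
      2 * (partEntropy p (C ⊓ A) + partEntropy p (D ⊓ A) - partEntropy p (C ⊓ D ⊓ A)
        - partEntropy p A) +
      (partEntropy p (C ⊓ B) + partEntropy p (D ⊓ B) - partEntropy p (C ⊓ D ⊓ B)
        - partEntropy p B) +
      (partEntropy p A + partEntropy p B - partEntropy p (A ⊓ B)) +
      (partEntropy p (C ⊓ A) + partEntropy p (C ⊓ D) - partEntropy p (C ⊓ D ⊓ A)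
        - partEntropy p C) +
      (partEntropy p (D ⊓ A) + partEntropy p (C ⊓ D) - partEntropy p (C ⊓ D ⊓ A)
        - partEntropy p D) := by
  set c := C ⊓ D with hc
  set p' := copyWeight p c with hp'
  have hp'0 : ∀ x, 0 ≤ p' x := copyWeight_nonneg hp c
  have hp'1 : ∑ x, p' x = 1 := sum_copyWeight_eq_one hp h1 c
  -- `R` is the copy of `A`, and `C`, `D` coincide on both coordinates.
  set R := A.comap (Prod.snd : Ω × Ω → Ω) with hR
  set A' := A.comap (Prod.fst : Ω × Ω → Ω) with hA'
  set B' := B.comap (Prod.fst : Ω × Ω → Ω) with hB'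
  set C' := C.comap (Prod.fst : Ω × Ω → Ω) with hC'
  set D' := D.comap (Prod.fst : Ω × Ω → Ω) with hD'
  have sub : ∀ r s t : Setoid (Ω × Ω), partEntropy p' (r ⊓ s ⊓ t) + partEntropy p' t ≤
      partEntropy p' (r ⊓ t) + partEntropy p' (s ⊓ t) := partEntropy_submodular hp'0
  have fst : ∀ r : Setoid Ω, partEntropy p' (r.comap Prod.fst) = partEntropy p r :=
    partEntropy_copy_fst hp c
  -- Given `(C,D)`, the copy `R` is independent of `A`, of `B` and of `(A,B)`; moreover `(R,C)` and
  -- `(R,D)` are distributed as `(A,C)` and `(A,D)`.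
  have e1 := partEntropy_copy hp A A c
  have e2 := partEntropy_copy hp B A c
  have e3 := partEntropy_copy hp (A ⊓ B) A c
  have e4 : partEntropy p' R = partEntropy p A := partEntropy_copy_snd hp c A
  have e5 : partEntropy p' (R ⊓ C') = partEntropy p (A ⊓ C) :=
    partEntropy_copy_snd_inf_fst hp inf_le_left A
  have e6 : partEntropy p' (R ⊓ D') = partEntropy p (A ⊓ D) :=
    partEntropy_copy_snd_inf_fst hp inf_le_right A
  have f1 : partEntropy p' C' = _ := fst C
  have f2 : partEntropy p' D' = _ := fst D
  have f3 : partEntropy p' (A' ⊓ C') = _ := fst (A ⊓ C)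
  have f4 : partEntropy p' (A' ⊓ D') = _ := fst (A ⊓ D)
  have f5 : partEntropy p' (B' ⊓ C') = _ := fst (B ⊓ C)
  have f6 : partEntropy p' (B' ⊓ D') = _ := fst (B ⊓ D)
  have f7 : partEntropy p' (A' ⊓ B') = _ := fst (A ⊓ B)
  have f8 : partEntropy p' (C' ⊓ D' ⊓ (A' ⊓ B')) = _ := fst (C ⊓ D ⊓ (A ⊓ B))
  -- `i3`, `i4`, `i7` give `I(R;A) ≥ I(C;D) - 2 I(C;D|A)`, and `i5`, `i6`, `i8` give `I(R;B) ≥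
  -- I(C;D) - I(C;D|A) - I(C;D|B)`. By `i1`, `I(R;A) + I(R;B) ≤ I(R;A,B) + I(A;B)`, and by `i2`,
  -- `I(R;A,B) ≤ I(R;C,D) = I(A;C,D)`. The last term equals `I(A;C|D) + I(A;D|C) + I(C;D) -
  -- I(C;D|A)`.
  have i1 := sub A' B' R
  have i2 := sub (C' ⊓ D') R (A' ⊓ B')
  have i3 := sub R A' C'
  have i4 := sub R A' D'
  have i5 := sub R B' C'
  have i6 := sub R B' D'
  have i7 := sub C' D' (R ⊓ A')
  have i8 := sub C' D' (R ⊓ B')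
  have hcomap : c.comap Prod.fst = C' ⊓ D' := rfl
  have hcomap' : (A ⊓ B).comap Prod.fst = A' ⊓ B' := rfl
  rw [hcomap, ← hA', ← hR, ← hp'] at e1
  rw [hcomap, ← hB', ← hR, ← hp'] at e2
  rw [hcomap, hcomap', ← hR, ← hp'] at e3
  rw [hc] at *
  -- A common normal form of the meets, so that equal joint entropies become equal atoms.
  simp only [inf_assoc, inf_comm, inf_left_comm] at *
  linarith

end Copy

/-! ### Privacy as a matching of keys; answers and contents as partitions. -/

namespace PIRCode

section Keys

variable {N K L : ℕ} {X Y F : Type*} {S Q : Fin N → Type*} [Fintype F] [Nonempty F]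

/-- Privacy, in terms of keys: the keys can be permuted so that the queries to server `n` for
message `k` become those for message `k'`. -/
theorem exists_perm_query_eq (C : PIRCode N K L X Y F S Q) (n : Fin N) (k k' : Fin K) :
    ∃ σ : Equiv.Perm F, ∀ f, C.query n k' (σ f) = C.query n k f := by
  classical
  -- The probability of a query is the size of its fibre over `|F|`, so privacy equates the fibre
  -- sizes; bijections between the fibres glue to a permutation.
  have hcard : ∀ j q, C.queryDist n j q =
      (Fintype.card {f // C.query n j f = q} : ENNReal) * (Fintype.card F : ENNReal)⁻¹ := by
    intro j q
    unfold PIRScheme.queryDist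
    rw [PMF.map_apply, tsum_fintype]
    simp only [PMF.uniformOfFintype_apply, eq_comm (a := q)]
    rw [← Finset.sum_filter, Finset.sum_const, nsmul_eq_mul, Fintype.card_subtype]
  have heq : ∀ q, Nonempty ({f // C.query n k f = q} ≃ {f // C.query n k' f = q}) := by
    intro q
    have h := C.privacy k k' n q
    rw [hcard, hcard] at h
    have h0 : (Fintype.card F : ENNReal)⁻¹ ≠ 0 := by simp
    have ht : (Fintype.card F : ENNReal)⁻¹ ≠ ⊤ := by simp
    rw [ENNReal.mul_left_inj h0 ht] at h
    exact Fintype.card_eq.1 (by exact_mod_cast h)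
  have e := fun q => (heq q).some
  refine ⟨(Equiv.sigmaFiberEquiv (C.query n k)).symm.trans
    ((Equiv.sigmaCongrRight e).trans (Equiv.sigmaFiberEquiv (C.query n k'))), fun f => ?_⟩
  exact (e (C.query n k f) ⟨f, rfl⟩).2

/-- Privacy: sums over the keys of functions of a query do not depend on the desired message. -/
theorem sum_query_eq (C : PIRCode N K L X Y F S Q) (n : Fin N) (k k' : Fin K) (g : Q n → ℝ) :
    ∑ f, g (C.query n k f) = ∑ f, g (C.query n k' f) := by
  obtain ⟨σ, hσ⟩ := C.exists_perm_query_eq n k k'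
  simp_rw [← hσ]
  exact Equiv.sum_comp σ fun f => g (C.query n k' f)

end Keys

section Variables

variable {N K L : ℕ} {X Y F : Type*} {S Q : Fin N → Type*} [Fintype F] [Nonempty F]

/-- The partition of the message tuples by the answer of server `n` to the query `q`. -/
def answerPart (C : PIRCode N K L X Y F S Q) (n : Fin N) (q : Q n) :
    Setoid (Fin K → Fin L → X) :=
  Setoid.ker fun w => C.answer n q (C.store n w)

/-- The partition of the message tuples by the content of database `n`. -/
def storePart (C : PIRCode N K L X Y F S Q) (n : Fin N) : Setoid (Fin K → Fin L → X) :=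
  Setoid.ker (C.store n)

theorem storePart_le_answerPart (C : PIRCode N K L X Y F S Q) (n : Fin N) (q : Q n) :
    C.storePart n ≤ C.answerPart n q := by
  intro w w' h
  exact congrArg (C.answer n q) h

end Variables

section TwoServers

variable {L : ℕ} {X Y F : Type*} {S Q : Fin 2 → Type*} [Fintype F] [Nonempty F]

theorem answerPart_inf_le (C : PIRCode 2 2 L X Y F S Q) (k : Fin 2) (f : F) :
    C.answerPart 0 (C.query 0 k f) ⊓ C.answerPart 1 (C.query 1 k f) ≤
      Setoid.ker fun w : Fin 2 → Fin L → X => w k := by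
  rintro w w' ⟨h0, h1⟩
  change w k = w' k
  rw [← C.correctness w k f, ← C.correctness w' k f]
  refine congrArg (C.decode k f) (funext fun n => ?_)
  fin_cases n
  · exact h0
  · exact h1

end TwoServers

end PIRCode

/-! ### Entropies of functions of the messages, and the inequality for linked answers. -/

section Messages

variable (L : ℕ) (X : Type*)

/-- The partition of the pairs of messages by message `k`. -/
def messagePart (k : Fin 2) : Setoid (Fin 2 → Fin L → X) :=
  Setoid.ker fun w => w k

theorem messagePart_inf {k j : Fin 2} (h : k ≠ j) : messagePart L X k ⊓ messagePart L X j = ⊥ := by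
  refine le_bot_iff.1 ?_
  rintro w w' ⟨h1, h2⟩
  have h1 : w k = w' k := h1
  have h2 : w j = w' j := h2
  change w = w'
  funext i
  have : i = k ∨ i = j := by omega
  rcases this with rfl | rfl
  · exact h1
  · exact h2

variable [Fintype X]

/-- The entropy of a function of the messages, which are independent and uniform. -/
noncomputable def msgEntropy (r : Setoid (Fin 2 → Fin L → X)) : ℝ :=
  partEntropy (fun _ => (Fintype.card (Fin 2 → Fin L → X) : ℝ)⁻¹) r

variable {L X}

theorem msgEntropy_anti {r s : Setoid (Fin 2 → Fin L → X)} (h : r ≤ s) :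
    msgEntropy L X s ≤ msgEntropy L X r :=
  partEntropy_anti (fun _ => by positivity) h

theorem msgEntropy_submodular (r s t : Setoid (Fin 2 → Fin L → X)) :
    msgEntropy L X (r ⊓ s ⊓ t) + msgEntropy L X t ≤
      msgEntropy L X (r ⊓ t) + msgEntropy L X (s ⊓ t) :=
  partEntropy_submodular (fun _ => by positivity) r s t

variable [Nonempty X]

theorem sum_uniform_eq_one : ∑ _w : Fin 2 → Fin L → X,
    (Fintype.card (Fin 2 → Fin L → X) : ℝ)⁻¹ = 1 := by
  have h : (Fintype.card (Fin 2 → Fin L → X) : ℝ) ≠ 0 := by exact_mod_cast Fintype.card_ne_zero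
  rw [Finset.sum_const, nsmul_eq_mul, Finset.card_univ, mul_inv_cancel₀ h]

theorem msgEntropy_inf_le_add (r s : Setoid (Fin 2 → Fin L → X)) :
    msgEntropy L X (r ⊓ s) ≤ msgEntropy L X r + msgEntropy L X s :=
  partEntropy_inf_le_add (fun _ => by positivity) sum_uniform_eq_one r s

theorem msgEntropy_ker_le {α : Type*} [Fintype α] (f : (Fin 2 → Fin L → X) → α) :
    msgEntropy L X (Setoid.ker f) ≤ Real.log (Fintype.card α) :=
  partEntropy_ker_le_log_card (fun _ => by positivity) sum_uniform_eq_one f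

theorem msgEntropy_bot : msgEntropy L X ⊥ = 2 * (L * Real.log (Fintype.card X)) := by
  unfold msgEntropy
  rw [partEntropy_uniform_bot]
  simp

/-- Each message has entropy at most `ℓ` by counting, and the two together have `2ℓ`, which forces
equality. -/
theorem msgEntropy_messagePart (k : Fin 2) :
    msgEntropy L X (messagePart L X k) = L * Real.log (Fintype.card X) := by
  have hle : ∀ j, msgEntropy L X (messagePart L X j) ≤ L * Real.log (Fintype.card X) := by
    intro j
    have h := msgEntropy_ker_le (X := X) (L := L) fun w => w j
    simp only [Fintype.card_fun, Fintype.card_fin, Nat.cast_pow, Real.log_pow] at h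
    exact h
  -- Addition in `Fin 2` wraps around, so `k + 1` is the other message.
  have hne : k ≠ k + 1 := by omega
  have h := msgEntropy_inf_le_add (messagePart L X k) (messagePart L X (k + 1))
  rw [messagePart_inf L X hne, msgEntropy_bot] at h
  linarith [hle k, hle (k + 1)]

/-- The entropy bound for two answers `A`, `A'` of one server, linked by an answer `B` of the other
one: message `0` is recovered from `A` and `B`, message `1` from `A'` and `B`. -/
theorem three_mul_msgEntropy_inf_ge {A A' B : Setoid (Fin 2 → Fin L → X)}
    (h1 : A' ⊓ B ≤ messagePart L X 1)
    (hA0 : msgEntropy L X (A ⊓ messagePart L X 0) = msgEntropy L X (A ⊓ B))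
    (hB0 : msgEntropy L X (B ⊓ messagePart L X 0) = msgEntropy L X (A ⊓ B))
    (hA1 : msgEntropy L X (A' ⊓ messagePart L X 1) = msgEntropy L X (A' ⊓ B))
    (hB1 : msgEntropy L X (B ⊓ messagePart L X 1) = msgEntropy L X (A' ⊓ B))
    (h0 : A ⊓ B ≤ messagePart L X 0)
    (hs0 : msgEntropy L X (A' ⊓ messagePart L X 0) + msgEntropy L X (B ⊓ messagePart L X 0) =
      3 * (L * Real.log (Fintype.card X)))
    (hs1 : msgEntropy L X (A ⊓ messagePart L X 1) + msgEntropy L X (B ⊓ messagePart L X 1) =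
      3 * (L * Real.log (Fintype.card X))) :
    2 * (msgEntropy L X A + msgEntropy L X A') + L * Real.log (Fintype.card X) ≤
      3 * msgEntropy L X (A ⊓ A') := by
  set W0 := messagePart L X 0 with hW0
  set W1 := messagePart L X 1 with hW1
  have hbot : W0 ⊓ W1 = ⊥ := messagePart_inf L X (by decide)
  -- `A`, `A'` and one message determine both messages.
  have key0 : 2 * (L * Real.log (Fintype.card X)) ≤ msgEntropy L X (A ⊓ A' ⊓ W0) := by
    -- Adjoining `B` to `(A,W0)` costs nothing, since `H(A,W0) = H(A,B)`; but with `B` and `A'` also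
    -- `W1` is known.
    have hsub := msgEntropy_submodular A' B (A ⊓ W0)
    have hle : A' ⊓ B ⊓ (A ⊓ W0) = ⊥ := by
      rw [← le_bot_iff, ← hbot]
      exact le_inf (inf_le_right.trans inf_le_right) (inf_le_left.trans h1)
    have hAB : B ⊓ (A ⊓ W0) = A ⊓ B := by
      rw [← inf_assoc, inf_comm B A]
      exact inf_eq_left.2 h0
    rw [hle, hAB, msgEntropy_bot, hA0, ← inf_assoc, inf_comm A' A] at hsub
    linarith
  have key1 : 2 * (L * Real.log (Fintype.card X)) ≤ msgEntropy L X (A ⊓ A' ⊓ W1) := by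
    have hsub := msgEntropy_submodular A B (A' ⊓ W1)
    have hle : A ⊓ B ⊓ (A' ⊓ W1) = ⊥ := by
      rw [← le_bot_iff, ← hbot]
      exact le_inf (inf_le_left.trans h0) (inf_le_right.trans inf_le_right)
    have hAB : B ⊓ (A' ⊓ W1) = A' ⊓ B := by
      rw [← inf_assoc, inf_comm B A']
      exact inf_eq_left.2 h1
    rw [hle, hAB, msgEntropy_bot, hA1, ← inf_assoc] at hsub
    linarith
  -- The messages play the independent pair. Both `I(A;A'|W0)` and `I(A;A'|W1)` are at most `3ℓ - 2ℓ
  -- - ℓ = 0`, and the last two terms sum to at most `2H(A,A') - H(A) - H(A') - ℓ`.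
  have zy : msgEntropy L X A + msgEntropy L X A' - msgEntropy L X (A ⊓ A') ≤ _ :=
    zhang_yeung (fun _ => by positivity) sum_uniform_eq_one W0 W1 A A'
  simp only [← msgEntropy.eq_1] at zy
  rw [hbot, msgEntropy_bot, hW0, hW1, msgEntropy_messagePart, msgEntropy_messagePart,
    ← hW0, ← hW1] at zy
  linarith

end Messages

/-! ### Tightness at capacity and the resulting storage bounds. -/

namespace PIRCode

section TwoServers

variable {L : ℕ} {X Y F : Type*} {S Q : Fin 2 → Type*} [Fintype F] [Nonempty F]
  [Fintype X] [Nonempty X]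

/-- The interference from the other message has at least the entropy of the desired one. -/
theorem interference_bound (C : PIRCode 2 2 L X Y F S Q) {k j : Fin 2} (h : k ≠ j) (f : F) :
    3 * (L * Real.log (Fintype.card X)) ≤
      msgEntropy L X (C.answerPart 0 (C.query 0 k f) ⊓ messagePart L X j) +
      msgEntropy L X (C.answerPart 1 (C.query 1 k f) ⊓ messagePart L X j) := by
  have hs := msgEntropy_submodular (C.answerPart 0 (C.query 0 k f))
    (C.answerPart 1 (C.query 1 k f)) (messagePart L X j)
  have hbot : C.answerPart 0 (C.query 0 k f) ⊓ C.answerPart 1 (C.query 1 k f) ⊓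
      messagePart L X j = ⊥ := by
    rw [← le_bot_iff, ← messagePart_inf L X h]
    exact inf_le_inf_right _ (C.answerPart_inf_le k f)
  rw [hbot, msgEntropy_bot, msgEntropy_messagePart] at hs
  linarith

variable [Fintype Y]

theorem msgEntropy_answerPart_le (C : PIRCode 2 2 L X Y F S Q) (n : Fin 2) (q : Q n) :
    msgEntropy L X (C.answerPart n q) ≤ C.len n q * Real.log (Fintype.card Y) := by
  have h := msgEntropy_ker_le fun w => C.answer n q (C.store n w)
  simp only [Fintype.card_fun, Fintype.card_fin, Nat.cast_pow, Real.log_pow] at h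
  exact h

/-- The total download for key `f`, in nats, when message `k` is desired. -/
noncomputable def totalLen (C : PIRCode 2 2 L X Y F S Q) (k : Fin 2) (f : F) : ℝ :=
  C.len 0 (C.query 0 k f) * Real.log (Fintype.card Y) +
    C.len 1 (C.query 1 k f) * Real.log (Fintype.card Y)

/-- The chain of inequalities that bounds the download of a single key from below. -/
theorem download_chain (C : PIRCode 2 2 L X Y F S Q) (k : Fin 2) (f : F) :
    let A := C.answerPart 0 (C.query 0 k f)
    let B := C.answerPart 1 (C.query 1 k f)
    msgEntropy L X (A ⊓ messagePart L X k) ≤ msgEntropy L X (A ⊓ B) ∧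
    msgEntropy L X (B ⊓ messagePart L X k) ≤ msgEntropy L X (A ⊓ B) ∧
    msgEntropy L X (A ⊓ B) ≤ msgEntropy L X A + msgEntropy L X B ∧
    msgEntropy L X A + msgEntropy L X B ≤ C.totalLen k f := by
  intro A B
  have hAB : A ⊓ B ≤ messagePart L X k := C.answerPart_inf_le k f
  exact ⟨msgEntropy_anti (le_inf inf_le_left hAB), msgEntropy_anti (le_inf inf_le_right hAB),
    msgEntropy_inf_le_add A B,
    add_le_add (C.msgEntropy_answerPart_le 0 _) (C.msgEntropy_answerPart_le 1 _)⟩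

/-- For a capacity-achieving code the bounds on the download are tight for every key. -/
theorem tight_of_sum_totalLen (C : PIRCode 2 2 L X Y F S Q)
    (hT : ∀ k, ∑ f, C.totalLen k f =
      Fintype.card F * (3 / 2 * (L * Real.log (Fintype.card X)))) {k j : Fin 2} (h : k ≠ j) :
    (∀ f, 2 * C.totalLen k f =
      msgEntropy L X (C.answerPart 0 (C.query 0 k f) ⊓ messagePart L X k) +
      msgEntropy L X (C.answerPart 1 (C.query 1 k f) ⊓ messagePart L X k)) ∧
    (∀ f, msgEntropy L X (C.answerPart 0 (C.query 0 j f) ⊓ messagePart L X k) +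
      msgEntropy L X (C.answerPart 1 (C.query 1 j f) ⊓ messagePart L X k) =
      3 * (L * Real.log (Fintype.card X))) := by
  set x0 : Q 0 → ℝ := fun q => msgEntropy L X (C.answerPart 0 q ⊓ messagePart L X k) with hx0
  set x1 : Q 1 → ℝ := fun q => msgEntropy L X (C.answerPart 1 q ⊓ messagePart L X k) with hx1
  have e0 : ∀ f, x0 (C.query 0 k f) + x1 (C.query 1 k f) ≤ 2 * C.totalLen k f := by
    intro f
    obtain ⟨h1, h2, h3, h4⟩ := C.download_chain k f
    simp only [hx0, hx1]
    linarith
  have d0 : ∀ f, 3 * (L * Real.log (Fintype.card X)) ≤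
      x0 (C.query 0 j f) + x1 (C.query 1 j f) := fun f => C.interference_bound h.symm f
  -- Privacy applies to each server separately, which suffices because each summand involves one
  -- query only.
  have hsum : ∑ f, (x0 (C.query 0 j f) + x1 (C.query 1 j f)) =
      ∑ f, (x0 (C.query 0 k f) + x1 (C.query 1 k f)) := by
    rw [Finset.sum_add_distrib, Finset.sum_add_distrib, C.sum_query_eq 0 j k x0,
      C.sum_query_eq 1 j k x1]
  have e := Finset.sum_le_sum fun f (_ : f ∈ Finset.univ) => e0 f
  have d := Finset.sum_le_sum fun f (_ : f ∈ Finset.univ) => d0 f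
  -- The lower and upper ends of the chain of sums coincide, so every termwise inequality is an
  -- equality.
  have hconst : ∑ _f : F, 3 * (L * Real.log (Fintype.card X)) = ∑ f, 2 * C.totalLen k f := by
    rw [← Finset.mul_sum Finset.univ (C.totalLen k), hT, Finset.sum_const, nsmul_eq_mul, Finset.card_univ]
    ring
  constructor
  · have := (Finset.sum_eq_sum_iff_of_le fun f (_ : f ∈ Finset.univ) => e0 f).1 (by linarith)
    exact fun f => (this f (Finset.mem_univ f)).symm
  · have := (Finset.sum_eq_sum_iff_of_le fun f (_ : f ∈ Finset.univ) => d0 f).1 (by linarith)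
    exact fun f => (this f (Finset.mem_univ f)).symm

/-- The two ends of `download_chain`, taken twice, agree by `tight_of_sum_totalLen`, so every link
is an equality. -/
theorem tight_chain (C : PIRCode 2 2 L X Y F S Q)
    (hT : ∀ k, ∑ f, C.totalLen k f =
      Fintype.card F * (3 / 2 * (L * Real.log (Fintype.card X)))) (k : Fin 2) (f : F) :
    let A := C.answerPart 0 (C.query 0 k f)
    let B := C.answerPart 1 (C.query 1 k f)
    msgEntropy L X (A ⊓ messagePart L X k) = msgEntropy L X (A ⊓ B) ∧
    msgEntropy L X (B ⊓ messagePart L X k) = msgEntropy L X (A ⊓ B) ∧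
    msgEntropy L X A + msgEntropy L X B = C.totalLen k f := by
  intro A B
  obtain ⟨h1, h2, h3, h4⟩ := C.download_chain k f
  have h := (C.tight_of_sum_totalLen hT (show k ≠ k + 1 by omega)).1 f
  refine ⟨?_, ?_, ?_⟩ <;> linarith

variable [∀ n, Fintype (S n)]

omit [Fintype Y] in
theorem log_card_store_ge (C : PIRCode 2 2 L X Y F S Q) (n : Fin 2) (q q' : Q n) :
    msgEntropy L X (C.answerPart n q ⊓ C.answerPart n q') ≤ Real.log (Fintype.card (S n)) :=
  (msgEntropy_anti (le_inf (C.storePart_le_answerPart n q) (C.storePart_le_answerPart n q'))).trans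
    (msgEntropy_ker_le (C.store n))

theorem store_zero_bound (C : PIRCode 2 2 L X Y F S Q)
    (hT : ∀ k, ∑ f, C.totalLen k f =
      Fintype.card F * (3 / 2 * (L * Real.log (Fintype.card X)))) :
    2 * (∑ f, msgEntropy L X (C.answerPart 0 (C.query 0 0 f)) +
        ∑ f, msgEntropy L X (C.answerPart 0 (C.query 0 1 f))) +
      Fintype.card F * (L * Real.log (Fintype.card X)) ≤
      Fintype.card F * (3 * Real.log (Fintype.card (S 0))) := by
  -- To bound database `0`, keys are matched through the query to server `1`, whose answer becomes
  -- the common `B`.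
  obtain ⟨σ, hσ⟩ := C.exists_perm_query_eq 1 0 1
  have key : ∀ f, 2 * (msgEntropy L X (C.answerPart 0 (C.query 0 0 f)) +
      msgEntropy L X (C.answerPart 0 (C.query 0 1 (σ f)))) + L * Real.log (Fintype.card X) ≤
      3 * Real.log (Fintype.card (S 0)) := by
    intro f
    obtain ⟨a1, a2, -⟩ := C.tight_chain hT 0 f
    obtain ⟨b1, b2, -⟩ := C.tight_chain hT 1 (σ f)
    have c0 := (C.tight_of_sum_totalLen hT (show (0 : Fin 2) ≠ 1 by decide)).2 (σ f)
    have c1 := (C.tight_of_sum_totalLen hT (show (1 : Fin 2) ≠ 0 by decide)).2 f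
    have m0 := C.answerPart_inf_le 0 f
    have m1 := C.answerPart_inf_le 1 (σ f)
    rw [hσ] at b1 b2 c0 m1
    have h := three_mul_msgEntropy_inf_ge m1 a1 a2 b1 b2 m0 c0 c1
    linarith [C.log_card_store_ge 0 (C.query 0 0 f) (C.query 0 1 (σ f))]
  have h := Finset.sum_le_sum fun f (_ : f ∈ Finset.univ) => key f
  rw [Finset.sum_add_distrib, ← Finset.mul_sum, Finset.sum_add_distrib,
    Equiv.sum_comp σ fun f => msgEntropy L X (C.answerPart 0 (C.query 0 1 f)),
    Finset.sum_const, Finset.sum_const, nsmul_eq_mul, nsmul_eq_mul, Finset.card_univ] at h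
  exact h

theorem store_one_bound (C : PIRCode 2 2 L X Y F S Q)
    (hT : ∀ k, ∑ f, C.totalLen k f =
      Fintype.card F * (3 / 2 * (L * Real.log (Fintype.card X)))) :
    2 * (∑ f, msgEntropy L X (C.answerPart 1 (C.query 1 0 f)) +
        ∑ f, msgEntropy L X (C.answerPart 1 (C.query 1 1 f))) +
      Fintype.card F * (L * Real.log (Fintype.card X)) ≤
      Fintype.card F * (3 * Real.log (Fintype.card (S 1))) := by
  obtain ⟨σ, hσ⟩ := C.exists_perm_query_eq 0 0 1
  have key : ∀ f, 2 * (msgEntropy L X (C.answerPart 1 (C.query 1 0 f)) +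
      msgEntropy L X (C.answerPart 1 (C.query 1 1 (σ f)))) + L * Real.log (Fintype.card X) ≤
      3 * Real.log (Fintype.card (S 1)) := by
    intro f
    obtain ⟨a1, a2, -⟩ := C.tight_chain hT 0 f
    obtain ⟨b1, b2, -⟩ := C.tight_chain hT 1 (σ f)
    have c0 := (C.tight_of_sum_totalLen hT (show (0 : Fin 2) ≠ 1 by decide)).2 (σ f)
    have c1 := (C.tight_of_sum_totalLen hT (show (1 : Fin 2) ≠ 0 by decide)).2 f
    have m0 := C.answerPart_inf_le 0 f
    have m1 := C.answerPart_inf_le 1 (σ f)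
    rw [hσ] at b1 b2 c0 m1
    -- Here server `0` supplies the common answer, so the two servers exchange roles.
    rw [inf_comm (C.answerPart 0 _) (C.answerPart 1 _)] at a1 a2 b1 b2 m0 m1
    rw [add_comm] at c0 c1
    have h := three_mul_msgEntropy_inf_ge m1 a2 a1 b2 b1 m0 c0 c1
    linarith [C.log_card_store_ge 1 (C.query 1 0 f) (C.query 1 1 (σ f))]
  have h := Finset.sum_le_sum fun f (_ : f ∈ Finset.univ) => key f
  rw [Finset.sum_add_distrib, ← Finset.mul_sum, Finset.sum_add_distrib,
    Equiv.sum_comp σ fun f => msgEntropy L X (C.answerPart 1 (C.query 1 1 f)),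
    Finset.sum_const, Finset.sum_const, nsmul_eq_mul, nsmul_eq_mul, Finset.card_univ] at h
  exact h

/-- For each desired message the two answer entropies sum to `3ℓ/2` on average, so adding the bounds
for both databases removes the individual answer entropies. -/
theorem log_card_store_add_ge (C : PIRCode 2 2 L X Y F S Q)
    (hT : ∀ k, ∑ f, C.totalLen k f =
      Fintype.card F * (3 / 2 * (L * Real.log (Fintype.card X)))) :
    8 / 3 * (L * Real.log (Fintype.card X)) ≤
      Real.log (Fintype.card (S 0)) + Real.log (Fintype.card (S 1)) := by
  have h : ∀ k, ∑ f, msgEntropy L X (C.answerPart 0 (C.query 0 k f)) +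
      ∑ f, msgEntropy L X (C.answerPart 1 (C.query 1 k f)) =
      Fintype.card F * (3 / 2 * (L * Real.log (Fintype.card X))) := by
    intro k
    rw [← hT k, ← Finset.sum_add_distrib]
    exact Finset.sum_congr rfl fun f _ => (C.tight_chain hT k f).2.2
  have hF : (0 : ℝ) < Fintype.card F := by exact_mod_cast Fintype.card_pos
  have hmul : Fintype.card F * (8 * (L * Real.log (Fintype.card X))) ≤
      Fintype.card F * (3 * (Real.log (Fintype.card (S 0)) + Real.log (Fintype.card (S 1)))) := by
    linarith [C.store_zero_bound hT, C.store_one_bound hT, h 0, h 1]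
  linarith [le_of_mul_le_mul_left hmul hF]

omit [Nonempty X] [∀ n, Fintype (S n)] in
theorem downloadCost_eq_sum_totalLen (C : PIRCode 2 2 L X Y F S Q) (k : Fin 2) :
    C.downloadCost k = (∑ f, C.totalLen k f) /
      (2 * Fintype.card F * (L * Real.log (Fintype.card X))) := by
  have h2 : Real.log 2 ≠ 0 := (Real.log_pos one_lt_two).ne'
  have hE : ∀ n, C.expectedLen n k =
      (∑ f, (C.len n (C.query n k f) : ℝ)) / Fintype.card F := by
    intro n
    simp only [PIRScheme.expectedLen, PMF.uniformOfFintype_apply, ENNReal.toReal_inv,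
      ENNReal.toReal_natCast]
    rw [← Finset.mul_sum, inv_mul_eq_div]
  have hn : ∀ n, C.downloadCostAt k n =
      (∑ f, (C.len n (C.query n k f) : ℝ)) * Real.log (Fintype.card Y) /
        (Fintype.card F * (L * Real.log (Fintype.card X))) := by
    intro n
    rw [downloadCostAt, hE, Real.logb, Real.logb, ← mul_div_assoc (L : ℝ), ← div_mul_eq_mul_div,
      div_div_div_cancel_right₀ h2]
    ring
  rw [downloadCost, Fin.sum_univ_two, hn, hn]
  simp only [totalLen, Finset.sum_add_distrib, ← Finset.sum_mul]
  push_cast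
  ring

end TwoServers

end PIRCode

theorem corollary3 {L : ℕ} {X Y F : Type*} {S Q : Fin 2 → Type*}
    [Fintype X] [Fintype Y] [Fintype F] [Nonempty F] [∀ n, Fintype (S n)]
    (hL : 1 ≤ L) (hX : 2 ≤ Fintype.card X)
    (C : PIRCode 2 2 L X Y F S Q) (k : Fin 2) (hβ : C.downloadCost k = 3 / 4) :
    4 / 3 ≤ C.storageCost := by
  have : Nonempty X := Fintype.card_pos_iff.1 (by omega)
  have hl : 0 < L * Real.log (Fintype.card X) :=
    mul_pos (by exact_mod_cast hL) (Real.log_pos (by exact_mod_cast hX))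
  have hF : (0 : ℝ) < Fintype.card F := by exact_mod_cast Fintype.card_pos
  have h2 : Real.log 2 ≠ 0 := (Real.log_pos one_lt_two).ne'
  have hT : ∀ j, ∑ f, C.totalLen j f =
      Fintype.card F * (3 / 2 * (L * Real.log (Fintype.card X))) := by
    intro j
    rw [C.downloadCost_eq k j, C.downloadCost_eq_sum_totalLen,
      div_eq_iff (by positivity)] at hβ
    linarith
  have h := C.log_card_store_add_ge hT
  have hn : ∀ n, C.storageCostAt n =
      Real.log (Fintype.card (S n)) / (L * Real.log (Fintype.card X)) := by
    intro n
    rw [PIRCode.storageCostAt, Real.logb, Real.logb, ← mul_div_assoc (L : ℝ),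
      div_div_div_cancel_right₀ h2]
  rw [PIRCode.storageCost, Fin.sum_univ_two, hn, hn, ← add_div]
  have := (le_div_iff₀ hl).2 h
  push_cast
  linarith
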